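/- Let $M$ be a von Neumann algebra acting on a complex Hilbert space $H$, let $G$ be a (discrete) group, and let $\alpha : G \to \mathrm{Aut}(M)$ be an action of $G$ on $M$ by $*$-automorphisms. Let $\mathbb{M} = M \times_\alpha G$ be the crossed product, i.e. the von Neumann algebra on $H \otimes \ell^2(G)$ generated by the operators $m$ ($m \in M$) and $u_g$ ($g \in G$), where $(m\xi)(h) = \alpha_{h^{-1}}(m)\,\xi(h)$ and $(u_g\xi)(h) = \xi(g^{-1}h)$, so that $u_g m = \alpha_g(m) u_g$. Let $E_M : \mathbb{M} \to M$, $E_M\big(\sum_{g} m_g u_g\big) = m_{e}$, be the canonical conditional expectation. Let $L(G)$ be the group von Neumann algebra, generated by the left regular representation $g \mapsto u_g$ on $\ell^2(G)$, with its canonical trace $tr\big(\sum_g r_g u_g\big) = r_{e}$. For a $B$-valued probability space $(A, E)$, a noncrossing partition $\pi \in NC(n)$ and $x_1, \dots, x_n \in A$, let $E_\pi(x_1, \dots, x_n) \in B$ be the partition-dependent (nested) moment: if $V = \{1 = i_1 < \dots < i_p\}$ is the block of $1$ and $\pi_1, \dots, \pi_p$ are the restrictions of $\pi$ to the gaps $\{i_k+1,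 \dots, i_{k+1}-1\}$ (with $i_{p+1} = n+1$), then $E_\pi(x_1,\dots,x_n) = E\big(x_{i_1} E_{\pi_1} x_{i_2} E_{\pi_2} \cdots E_{\pi_{p-1}} x_{i_p}\big)\, E_{\pi_p}$, where $E_{\pi_k}$ is evaluated at the $x_i$ of its gap and is $1$ for an empty gap; for example, $E_\pi(x_1,\dots,x_5) = E(x_1 E(x_2x_3)x_4)\,E(x_5)$ for $\pi = \{(1,4),(2,3),(5)\}$. Let $$k_n^{E}(x_1, \dots, x_n) = \sum_{\pi \in NC(n)} E_\pi(x_1, \dots, x_n)\, \mu(\pi, 1_n)$$ be the $n$-th free cumulant, where $\mu$ is the Möbius function of the lattice $NC(n)$ (ordered by refinement) and $1_n$ is its maximal element. **Theorem.** For all $n$, all $g_1, \dots, g_n \in G$ and all $m_1, \dots, m_n \in M$, $$k_n^{E_M}(m_1 u_{g_1}, \dots, m_n u_{g_n}) = \big(m_1\, \alpha_{g_1}(m_2)\, \alpha_{g_1 g_2}(m_3) \cdots \alpha_{g_1 \cdots g_{n-1}}(m_n)\big)\; k_n^{tr}(u_{g_1}, \dots, u_{g_n}),$$ where the cumulant on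 the right is the scalar-valued free cumulant in $(L(G), tr)$. Moreover, for every noncrossing partition $\pi \in NC(n)$, $$E_{M,\pi}(m_1 u_{g_1}, \dots, m_n u_{g_n}) = \big(m_1\, \alpha_{g_1}(m_2) \cdots \alpha_{g_1 \cdots g_{n-1}}(m_n)\big)\; tr_\pi(u_{g_1}, \dots, u_{g_n}).$$ -/

import Mathlib

open scoped ENNReal

noncomputable section

namespace CrossedProduct

/-! ### Noncrossing partitions, nested moments and free cumulants -/

/-- A partition of `{0, …, n-1}` is noncrossing if there are no `a < b < c < d` with `a, c` in one
block and `b, d` in another one. -/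
def IsNoncrossing {n : ℕ} (π : Finpartition (Finset.univ : Finset (Fin n))) : Prop :=
  ∀ V ∈ π.parts, ∀ W ∈ π.parts, ∀ a b c d : Fin n, a < b → b < c → c < d →
    a ∈ V → c ∈ V → b ∈ W → d ∈ W → V = W

/-- `NC(n)`, ordered by refinement: `π ≤ θ` iff every block of `π` is contained in a block
of `θ`. -/
def NC (n : ℕ) : Type :=
  {π : Finpartition (Finset.univ : Finset (Fin n)) // IsNoncrossing π}

namespace NC

variable {n : ℕ}

instance : PartialOrder (NC n) := Subtype.partialOrder _

instance : DecidableEq (NC n) := Classical.decEq _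

instance : Fintype (NC n) := by
  classical exact inferInstanceAs
    (Fintype {π : Finpartition (Finset.univ : Finset (Fin n)) // IsNoncrossing π})

instance : LocallyFiniteOrder (NC n) := by
  classical exact Fintype.toLocallyFiniteOrder

/-- The maximal element `1_n` of `NC(n)`, the partition with only one block. -/
def one (n : ℕ) : NC n :=
  ⟨⊤, fun _ hV _ hW _ _ _ _ _ _ _ _ _ _ _ ↦
    (Finset.mem_singleton.1 (Finpartition.parts_top_subset _ hV)).trans
      (Finset.mem_singleton.1 (Finpartition.parts_top_subset _ hW)).symm⟩

/-- The Möbius function of the lattice `NC(n)`. -/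
def moebius (π θ : NC n) : ℤ := IncidenceAlgebra.mu ℤ π θ

end NC

section Moments

variable {ι κ A B : Type*} [Ring A] [Ring B] [DecidableEq κ]

/-- The nested moment of the word `x_i, i ∈ l`, where `c i` is the block of the letter `i`.

In the state `none` no block is open: the moment of the empty word is `1`, and otherwise the first
letter opens its block. In the state `some (k, a)` the block `k` is open, `a` is what has been
accumulated for it, and `l` is the rest of the word. If `l` has no further letter of the block `k`,
then `k` contributes the factor `E a`, which is followed by the moment of `l`. Otherwise
`l = l₁ ++ i :: l₂`, where `i` is the next letter of the block `k`, and the moment of the letters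
`l₁` nested between is inserted in front of `x_i`. -/
def nestedMoment (j : B → A) (E : A → B) (c : ι → κ) (x : ι → A) : Option (κ × A) → List ι → B
  | none, [] => 1
  | none, i :: l => nestedMoment j E c x (some (c i, x i)) l
  | some (k, a), l =>
    match _h : l.dropWhile (fun i ↦ c i ≠ k) with
    | [] => E a * nestedMoment j E c x none l
    | i :: l₂ =>
      nestedMoment j E c x
        (some (k, a * j (nestedMoment j E c x none (l.takeWhile (fun i ↦ c i ≠ k))) * x i)) l₂
termination_by s l => (l.length, if s.isSome then 1 else 0)
decreasing_by
  · exact Prod.Lex.left _ _ (by simp)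
  · exact Prod.Lex.right _ (by simp)
  · have h1 := (List.takeWhile_sublist (fun i ↦ decide (c i ≠ k)) (l := l)).length_le
    rcases h1.lt_or_eq with h1 | h1
    · exact Prod.Lex.left _ _ h1
    · rw [h1]; exact Prod.Lex.right _ (by simp)
  · have h1 := (List.dropWhile_sublist (fun i ↦ decide (c i ≠ k)) (l := l)).length_le
    rw [_h, List.length_cons] at h1
    exact Prod.Lex.left _ _ (by omega)

/-- The partition-dependent moment `E_π(x_1, …, x_n)` of a `B`-valued probability space `(A, E)`,
where `j` is the inclusion of `B` into `A`. For example,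
`E_π(x_1, …, x_5) = E(x_1 E(x_2 x_3) x_4) E(x_5)` for `π = {(1,4), (2,3), (5)}`. -/
def partitionMoment (j : B → A) (E : A → B) {n : ℕ} (x : Fin n → A) (π : NC n) : B :=
  nestedMoment j E π.1.part x none (List.finRange n)

/-- The free cumulant `k_n(x_1, …, x_n) = ∑_{π ∈ NC(n)} E_π(x_1, …, x_n) μ(π, 1_n)`. -/
def freeCumulant (j : B → A) (E : A → B) {n : ℕ} (x : Fin n → A) : B :=
  ∑ π : NC n, NC.moebius π (NC.one n) • partitionMoment j E x π

end Moments

/-! ### Von Neumann algebras -/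

section VonNeumann

variable {K : Type*} [NormedAddCommGroup K] [InnerProductSpace ℂ K] [CompleteSpace K]

instance : SMulMemClass (VonNeumannAlgebra K) ℂ (K →L[ℂ] K) where
  smul_mem {M} r _ hx := M.toStarSubalgebra.smul_mem hx r

/-- The von Neumann algebra generated by a set of operators, the double commutant of the
self-adjoint set `S ∪ S*`. -/
def vonNeumannClosure (S : Set (K →L[ℂ] K)) : VonNeumannAlgebra K where
  toStarSubalgebra :=
    StarSubalgebra.centralizer ℂ (StarSubalgebra.centralizer ℂ S : Set (K →L[ℂ] K))
  centralizer_centralizer' := by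
    change Set.centralizer (Set.centralizer
      ((StarSubalgebra.centralizer ℂ (StarSubalgebra.centralizer ℂ S : Set (K →L[ℂ] K)) :
        StarSubalgebra ℂ (K →L[ℂ] K)) : Set (K →L[ℂ] K))) =
      ((StarSubalgebra.centralizer ℂ (StarSubalgebra.centralizer ℂ S : Set (K →L[ℂ] K)) :
        StarSubalgebra ℂ (K →L[ℂ] K)) : Set (K →L[ℂ] K))
    rw [StarSubalgebra.coe_centralizer_centralizer, Set.centralizer_centralizer_centralizer]

theorem mem_vonNeumannClosure {S : Set (K →L[ℂ] K)} {x : K →L[ℂ] K} :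
    x ∈ vonNeumannClosure S ↔ x ∈ Set.centralizer (Set.centralizer (S ∪ star S)) := by
  rw [← StarSubalgebra.coe_centralizer_centralizer ℂ]
  rfl

theorem subset_vonNeumannClosure {S : Set (K →L[ℂ] K)} {x : K →L[ℂ] K} (hx : x ∈ S) :
    x ∈ vonNeumannClosure S :=
  mem_vonNeumannClosure.2 (Set.subset_centralizer_centralizer (Or.inl hx))

theorem norm_aut_apply (M : VonNeumannAlgebra K) (φ : M ≃⋆ₐ[ℂ] M) (m : M) :
    ‖(φ m : K →L[ℂ] K)‖ = ‖(m : K →L[ℂ] K)‖ := by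
  have : IsClosed (M : Set (K →L[ℂ] K)) := by
    rw [← M.centralizer_centralizer]
    exact Set.isClosed_centralizer _
  exact StarAlgEquiv.norm_map φ m

end VonNeumann

/-! ### Operators on `H ⊗ ℓ²(G)` -/

section Operators

/-- The Hilbert space `H ⊗ ℓ²(G) = ℓ²(G, H)`. -/
abbrev L2 (G H : Type*) [NormedAddCommGroup H] : Type _ := lp (fun _ : G ↦ H) 2

variable {G : Type*} {H : Type*} [NormedAddCommGroup H] [InnerProductSpace ℂ H]

/-- The left regular representation on `H ⊗ ℓ²(G)`: `(u_g ξ)(h) = ξ(g⁻¹ h)`. -/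
def leftTranslation [Group G] (H : Type*) [NormedAddCommGroup H] [InnerProductSpace ℂ H] (g : G) :
    L2 G H →L[ℂ] L2 G H :=
  LinearMap.mkContinuous
    { toFun := fun ξ ↦ ⟨fun h ↦ ξ (g⁻¹ * h), by
        refine memℓp_gen ?_
        exact (Equiv.mulLeft g⁻¹).summable_iff.2 ((lp.memℓp ξ).summable (by simp))⟩
      map_add' := fun _ _ ↦ rfl
      map_smul' := fun _ _ ↦ rfl }
    1 (fun ξ ↦ by
      rw [one_mul]
      refine le_of_eq ?_
      rw [lp.norm_eq_tsum_rpow (by simp), lp.norm_eq_tsum_rpow (by simp)]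
      congr 1
      exact (Equiv.mulLeft g⁻¹).tsum_eq (fun h ↦ ‖ξ h‖ ^ (2 : ℝ≥0∞).toReal))

@[simp]
theorem leftTranslation_apply [Group G] (g : G) (ξ : L2 G H) (h : G) :
    leftTranslation H g ξ h = ξ (g⁻¹ * h) := rfl

theorem leftTranslation_star [CompleteSpace H] [Group G] (g : G) :
    leftTranslation H g⁻¹ = star (leftTranslation H g) := by
  rw [ContinuousLinearMap.star_eq_adjoint, ContinuousLinearMap.eq_adjoint_iff]
  intro ξ η
  rw [lp.inner_eq_tsum, lp.inner_eq_tsum,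
    ← (Equiv.mulLeft g).tsum_eq (fun h ↦ inner ℂ (ξ h) (leftTranslation H g η h))]
  simp

open Classical in
/-- The matrix entry of an operator on `H ⊗ ℓ²(G)` at the identity of `G`:
`ξ ↦ (x (ξ ⊗ δ_e))(e)`. -/
def entry [Group G] (x : L2 G H →L[ℂ] L2 G H) : H →L[ℂ] H :=
  (lp.evalCLM ℂ (fun _ : G ↦ H) 2 1) ∘L x ∘L (lp.singleContinuousLinearMap ℂ (fun _ : G ↦ H) 2 1)

open Classical in
theorem entry_apply [Group G] (x : L2 G H →L[ℂ] L2 G H) (ξ : H) :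
    entry x ξ = x (lp.single 2 1 ξ) 1 := rfl

/-! ### The group von Neumann algebra `(L(G), tr)` -/

section GroupVonNeumann

variable (G) [Group G]

/-- `L(G)`, the von Neumann algebra on `ℓ²(G)` generated by the left regular representation. -/
def groupVN : VonNeumannAlgebra (L2 G ℂ) :=
  vonNeumannClosure (Set.range (leftTranslation (G := G) ℂ))

variable {G}

/-- The unitary `u_g` in `L(G)`. -/
def groupVN.u (g : G) : groupVN G :=
  ⟨leftTranslation ℂ g, subset_vonNeumannClosure ⟨g, rfl⟩⟩

/-- The canonical trace `tr(∑ r_g u_g) = r_e` on `L(G)`. The coefficients of `y = ∑ r_g u_g` are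
determined by `y δ_e = ∑ r_g δ_g`. -/
def groupVN.tr : groupVN G →ₗ[ℂ] ℂ where
  toFun y := entry (y : L2 G ℂ →L[ℂ] L2 G ℂ) 1
  map_add' _ _ := rfl
  map_smul' r y := by
    change (r • ((y : L2 G ℂ →L[ℂ] L2 G ℂ) _)) 1 = _
    rfl

end GroupVonNeumann

/-! ### The crossed product `(M ×_α G, E_M)` -/

section Crossed

variable [CompleteSpace H] [Group G] (M : VonNeumannAlgebra H) (α : G →* (M ≃⋆ₐ[ℂ] M))

/-- The representation of `M` on `H ⊗ ℓ²(G)`: `(m ξ)(h) = α_{h⁻¹}(m) ξ(h)`. -/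
def rep (m : M) : L2 G H →L[ℂ] L2 G H :=
  lp.mapCLM 2 (fun h : G ↦ (α h⁻¹ m : H →L[ℂ] H)) (norm_nonneg (m : H →L[ℂ] H))
    (fun h ↦ (norm_aut_apply M (α h⁻¹) m).le)

@[simp]
theorem rep_apply (m : M) (ξ : L2 G H) (h : G) :
    rep M α m ξ h = (α h⁻¹ m : H →L[ℂ] H) (ξ h) := rfl

theorem rep_star (m : M) : rep M α (star m) = star (rep M α m) := by
  rw [ContinuousLinearMap.star_eq_adjoint, ContinuousLinearMap.eq_adjoint_iff]
  intro ξ η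
  rw [lp.inner_eq_tsum, lp.inner_eq_tsum]
  congr 1
  ext h
  rw [rep_apply, rep_apply, map_star]
  exact ContinuousLinearMap.adjoint_inner_left _ _ _

/-- The crossed product `M ×_α G`, the von Neumann algebra on `H ⊗ ℓ²(G)` generated by `M` and the
unitaries `u_g`. -/
def crossedProduct : VonNeumannAlgebra (L2 G H) :=
  vonNeumannClosure (Set.range (rep M α) ∪ Set.range (leftTranslation (G := G) H))

variable {M}

/-- The inclusion of `M` into `M ×_α G`. -/
def crossedProduct.ofM : M →⋆ₐ[ℂ] crossedProduct M α where
  toFun m := ⟨rep M α m, subset_vonNeumannClosure (Or.inl ⟨m, rfl⟩)⟩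
  map_one' := by ext; simp
  map_mul' _ _ := by ext; simp
  map_zero' := by ext; simp
  map_add' _ _ := by ext; simp
  commutes' r := by
    ext
    simp only [rep_apply, AlgHomClass.commutes]
    rfl
  map_star' m := by
    ext1; exact rep_star M α m

/-- The unitary `u_g` in `M ×_α G`. -/
def crossedProduct.u (g : G) : crossedProduct M α :=
  ⟨leftTranslation H g, subset_vonNeumannClosure (Or.inr ⟨g, rfl⟩)⟩

theorem entry_mem (x : crossedProduct M α) : entry (x : L2 G H →L[ℂ] L2 G H) ∈ M := by
  classical
  rw [← SetLike.mem_coe, ← M.centralizer_centralizer]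
  intro y hy
  -- the diagonal operator with constant entry `y` commutes with the crossed product
  let Y : L2 G H →L[ℂ] L2 G H := lp.mapCLM 2 (fun _ : G ↦ y) (norm_nonneg y) (fun _ ↦ le_rfl)
  have hY (ξ : L2 G H) (h : G) : Y ξ h = y (ξ h) := rfl
  have hu (g : G) : leftTranslation H g * Y = Y * leftTranslation H g := rfl
  have hm (m : M) : rep M α m * Y = Y * rep M α m := by
    ext ξ h
    exact congrArg (fun T : H →L[ℂ] H ↦ T (ξ h)) (hy _ (α h⁻¹ m).2)
  have hYS : Y ∈ Set.centralizer ((Set.range (rep M α) ∪ Set.range (leftTranslation (G := G) H)) ∪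
      star (Set.range (rep M α) ∪ Set.range (leftTranslation (G := G) H))) := by
    rintro z (hz | hz)
    · rcases hz with ⟨m, rfl⟩ | ⟨g, rfl⟩
      · exact hm m
      · exact hu g
    · rcases hz with ⟨m, hz⟩ | ⟨g, hz⟩
      · rw [← star_star z, ← hz, ← rep_star]
        exact hm _
      · rw [← star_star z, ← hz, ← leftTranslation_star]
        exact hu _
  have hx := mem_vonNeumannClosure.1 x.2 Y hYS
  ext ξ
  have h1 := congrArg (fun T : L2 G H →L[ℂ] L2 G H ↦ T (lp.single 2 1 ξ) 1) hx
  have h2 : Y (lp.single 2 1 ξ) = lp.single 2 1 (y ξ) := by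
    ext h
    rw [hY]
    by_cases hh : h = 1
    · subst hh; simp
    · simp [hh]
  simp only [mul_apply_eq_comp, h2, hY] at h1
  simpa only [mul_apply_eq_comp, entry_apply] using h1

/-- The canonical conditional expectation `E_M(∑ m_g u_g) = m_e` from `M ×_α G` onto `M`. The
coefficients of `x = ∑ m_g u_g` are determined by `x (ξ ⊗ δ_e) = ∑ α_{g⁻¹}(m_g) ξ ⊗ δ_g`. -/
def crossedProduct.condExp : crossedProduct M α →ₗ[ℂ] M where
  toFun x := ⟨entry (x : L2 G H →L[ℂ] L2 G H), entry_mem α x⟩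
  map_add' _ _ := rfl
  map_smul' _ _ := rfl

/-- The twisted product `m_1 α_{g_1}(m_2) α_{g_1 g_2}(m_3) ⋯ α_{g_1 ⋯ g_{n-1}}(m_n)`. -/
def twistedProduct {n : ℕ} (g : Fin n → G) (m : Fin n → M) : M :=
  (List.ofFn fun i : Fin n ↦ α ((List.ofFn g).take i).prod (m i)).prod

end Crossed

end Operators

end CrossedProduct

end

namespace CrossedProduct

/-! ### Unfolding equations of the nested moment. -/

section NestedMoment

variable {ι κ A B : Type*} [Ring A] [Ring B] [DecidableEq κ]
  (j : B → A) (E : A → B) (c : ι → κ) (x : ι → A)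

/-! By covariance every product of letters `m_i u_{g_i}` has the form `b u_a`, and `E_M (b u_a)` is
`b` or `0` according to whether `tr u_a` is `1` or `0`. The two nested moments thus run in parallel;
the only issue is the twist. A letter following a nested subword `l₁` carries the twist `α_p` in the
full twisted product, `p` being the product of the group elements of `l₁`, while in the nested
moment `l₁` has been replaced by an element of `M` and this twist is absent. But if `p ≠ 1`, the
trace moment of `l₁` vanishes and both sides are zero; if `p = 1`, the twists agree.
`nestedMoment_some_eq_smul` carries this by proving the factorization together with the statement
that a nonzero trace moment forces the group product to be `1`. The cumulant formula follows by
summing over partitions with the same Möbius weights. -/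

theorem nestedMoment_none_nil : nestedMoment j E c x none [] = 1 := by
  rw [nestedMoment]

theorem nestedMoment_none_cons (i : ι) (l : List ι) :
    nestedMoment j E c x none (i :: l) = nestedMoment j E c x (some (c i, x i)) l := by
  rw [nestedMoment]

theorem nestedMoment_some_of_dropWhile_eq_nil {k : κ} {l : List ι}
    (h : l.dropWhile (fun i ↦ c i ≠ k) = []) (a : A) :
    nestedMoment j E c x (some (k, a)) l = E a * nestedMoment j E c x none l := by
  rw [nestedMoment]
  split
  · rfl
  · next h' => rw [h] at h'; cases h'

theorem nestedMoment_some_of_dropWhile_eq_cons {k : κ} {l l₂ : List ι} {i : ι}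
    (h : l.dropWhile (fun i ↦ c i ≠ k) = i :: l₂) (a : A) :
    nestedMoment j E c x (some (k, a)) l = nestedMoment j E c x
      (some (k, a * j (nestedMoment j E c x none (l.takeWhile (fun i ↦ c i ≠ k))) * x i)) l₂ := by
  rw [nestedMoment]
  split
  · next h' => rw [h] at h'; cases h'
  · next h' => rw [h] at h'; cases h'; rfl

end NestedMoment

section Crossed

variable {G H : Type*} [NormedAddCommGroup H] [InnerProductSpace ℂ H] [CompleteSpace H] [Group G]
  {M : VonNeumannAlgebra H} (α : G →* (M ≃⋆ₐ[ℂ] M))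

/-! ### Algebra of the generators and values of the two expectations. -/

theorem groupVN.u_mul (g h : G) : groupVN.u (g * h) = groupVN.u g * groupVN.u h := by
  ext ξ k
  change ξ _ = ξ _
  rw [mul_inv_rev, mul_assoc]

open Classical in
theorem groupVN.tr_u (g : G) : groupVN.tr (groupVN.u g) = if g = 1 then 1 else 0 := by
  change (lp.single 2 (1 : G) (1 : ℂ) : L2 G ℂ) (g⁻¹ * 1) = _
  by_cases hg : g = 1
  · subst hg; simp
  · simp [hg]

theorem crossedProduct.u_mul (g h : G) :
    crossedProduct.u α (g * h) = crossedProduct.u α g * crossedProduct.u α h := by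
  ext ξ k
  change ξ _ = ξ _
  rw [mul_inv_rev, mul_assoc]

/-- The covariance relation `u_g m = α_g(m) u_g`. -/
theorem crossedProduct.u_mul_ofM (g : G) (m : M) :
    crossedProduct.u α g * crossedProduct.ofM α m =
      crossedProduct.ofM α (α g m) * crossedProduct.u α g := by
  ext ξ k
  change (α (g⁻¹ * k)⁻¹ m : H →L[ℂ] H) (ξ (g⁻¹ * k)) =
    (α k⁻¹ (α g m) : H →L[ℂ] H) (ξ (g⁻¹ * k))
  rw [mul_inv_rev, inv_inv, map_mul]
  rfl

/-- One step of accumulation in an open block: `b u_a` is what was read so far, `p` the nested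
moment, `q u_h` the next letter of the block. -/
theorem crossedProduct.ofM_mul_u_mul (b p q : M) (a h : G) :
    crossedProduct.ofM α b * crossedProduct.u α a * crossedProduct.ofM α p *
        (crossedProduct.ofM α q * crossedProduct.u α h) =
      crossedProduct.ofM α (b * α a (p * q)) * crossedProduct.u α (a * h) := by
  rw [mul_assoc, ← mul_assoc (crossedProduct.ofM α p), ← map_mul, mul_assoc,
    ← mul_assoc (crossedProduct.u α a), crossedProduct.u_mul_ofM, map_mul _ b,
    crossedProduct.u_mul]
  simp only [mul_assoc]

open Classical in
theorem crossedProduct.condExp_ofM_mul_u (m : M) (g : G) :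
    crossedProduct.condExp α (crossedProduct.ofM α m * crossedProduct.u α g) =
      if g = 1 then m else 0 := by
  ext ξ
  change (α 1⁻¹ m : H →L[ℂ] H) ((lp.single 2 (1 : G) ξ : L2 G H) (g⁻¹ * 1)) = _
  by_cases hg : g = 1
  · subst hg; simp
  · simp [hg]

/-! ### Twisted coefficients of words. -/

/-- The product of the twisted coefficients of a word: `m_i u_{g_i}`, `i ∈ l`, multiplies to
`twistedWord α g m l • u_{∏ g_i}`. -/
noncomputable def twistedWord {ι : Type*} (g : ι → G) (m : ι → M) : List ι → M
  | [] => 1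
  | i :: l => m i * α (g i) (twistedWord g m l)

theorem twistedWord_append {ι : Type*} (g : ι → G) (m : ι → M) (l₁ l₂ : List ι) :
    twistedWord α g m (l₁ ++ l₂) =
      twistedWord α g m l₁ * α (l₁.map g).prod (twistedWord α g m l₂) := by
  induction l₁ with
  | nil => simp [twistedWord]
  | cons i l₁ ih => simp [twistedWord, ih, mul_assoc]

theorem twistedWord_map {ι ι' : Type*} (f : ι' → ι) (g : ι → G) (m : ι → M) (l : List ι') :
    twistedWord α g m (l.map f) = twistedWord α (g ∘ f) (m ∘ f) l := by
  induction l with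
  | nil => rfl
  | cons i l ih => simp [twistedWord, ih]

/-- The prefix `a` is there for the induction: removing the first letter turns it into `a * g 0`. -/
theorem map_prod_ofFn_take {n : ℕ} (a : G) (g : Fin n → G) (m : Fin n → M) :
    (List.ofFn fun i : Fin n ↦ α (a * ((List.ofFn g).take i).prod) (m i)).prod =
      α a (twistedWord α g m (List.finRange n)) := by
  induction n generalizing a with
  | zero => simp [twistedWord]
  | succ n ih =>
    have h := ih (a * g 0) (g ∘ Fin.succ) (m ∘ Fin.succ)
    rw [List.finRange_succ, twistedWord, twistedWord_map]
    simpa [List.ofFn_succ, mul_assoc, Function.comp_def] using congrArg (α a (m 0) * ·) h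

theorem twistedProduct_eq_twistedWord {n : ℕ} (g : Fin n → G) (m : Fin n → M) :
    twistedProduct α g m = twistedWord α g m (List.finRange n) := by
  simpa [twistedProduct] using map_prod_ofFn_take α 1 g m

/-! ### Comparison of the nested moments. -/

variable {ι κ : Type*} [DecidableEq κ] (c : ι → κ) (g : ι → G) (m : ι → M)

local notation "momentM" => nestedMoment (crossedProduct.ofM α) (crossedProduct.condExp α) c
  (fun i ↦ crossedProduct.ofM α (m i) * crossedProduct.u α (g i))

local notation "momentTr" => nestedMoment (algebraMap ℂ (groupVN G)) groupVN.tr c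
  (fun i ↦ groupVN.u (g i))

/-- The first letter opens a block and leaves a shorter word, so the claim with no open block needs
the open-block claim only at strictly smaller length. -/
theorem nestedMoment_none_of_nestedMoment_some {l : List ι}
    (h : ∀ l' : List ι, l'.length < l.length → ∀ (k : κ) (r : ℂ) (b : M) (a : G),
      momentM (some (k, r • (crossedProduct.ofM α b * crossedProduct.u α a))) l' =
        momentTr (some (k, r • groupVN.u a)) l' • (b * α a (twistedWord α g m l')) ∧
      (momentTr (some (k, r • groupVN.u a)) l' ≠ 0 → r ≠ 0 ∧ a * (l'.map g).prod = 1)) :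
    momentM none l = momentTr none l • twistedWord α g m l ∧
      (momentTr none l ≠ 0 → (l.map g).prod = 1) := by
  cases l with
  | nil => simp [nestedMoment_none_nil, twistedWord]
  | cons i l =>
    have := h l (by simp) (c i) 1 (m i) (g i)
    simp only [one_smul] at this
    rw [nestedMoment_none_cons, nestedMoment_none_cons, List.map_cons, List.prod_cons]
    exact ⟨this.1, fun h0 ↦ (this.2 h0).2⟩

/-- The scalar `r` collects the trace moments of the subwords already nested in the open block.
Concluding `r ≠ 0` lets each of these be recovered as nonzero. -/
theorem nestedMoment_some_eq_smul (l : List ι) (k : κ) (r : ℂ) (b : M) (a : G) :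
    momentM (some (k, r • (crossedProduct.ofM α b * crossedProduct.u α a))) l =
        momentTr (some (k, r • groupVN.u a)) l • (b * α a (twistedWord α g m l)) ∧
      (momentTr (some (k, r • groupVN.u a)) l ≠ 0 → r ≠ 0 ∧ a * (l.map g).prod = 1) := by
  induction hN : l.length using Nat.strong_induction_on generalizing l k r b a with
  | _ N ih =>
  subst hN
  have ih' (l' : List ι) (hl' : l'.length < l.length) := fun k r b a ↦ ih _ hl' l' k r b a rfl
  cases hd : l.dropWhile (fun i ↦ c i ≠ k) with
  -- The block closes: both expectations vanish unless `a = 1`, and then `α a` is trivial on the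
  -- rest of the word.
  | nil =>
    obtain ⟨h1, h2⟩ := nestedMoment_none_of_nestedMoment_some α c g m ih'
    rw [nestedMoment_some_of_dropWhile_eq_nil _ _ _ _ hd,
      nestedMoment_some_of_dropWhile_eq_nil _ _ _ _ hd, h1, map_smul, map_smul,
      crossedProduct.condExp_ofM_mul_u, groupVN.tr_u]
    by_cases ha : a = 1
    · subst ha
      simp only [if_true, map_one, smul_eq_mul, mul_one, one_mul, ne_eq, mul_eq_zero, not_or]
      refine ⟨?_, fun h ↦ ⟨h.1, h2 h.2⟩⟩
      rw [smul_mul_smul_comm]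
      rfl
    · simp [ha]
  | cons i l₂ =>
    rw [nestedMoment_some_of_dropWhile_eq_cons _ _ _ _ hd,
      nestedMoment_some_of_dropWhile_eq_cons _ _ _ _ hd]
    have hl := List.takeWhile_append_dropWhile (p := fun i ↦ decide (c i ≠ k)) (l := l)
    rw [hd] at hl
    generalize l.takeWhile (fun i ↦ decide (c i ≠ k)) = l₁ at hl ⊢
    subst hl
    obtain ⟨h1, h2⟩ := nestedMoment_none_of_nestedMoment_some α c g m (l := l₁)
      (fun l' hl' ↦ ih' l' (hl'.trans_le (by simp)))
    rw [h1]
    set t := momentTr none l₁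
    have eM : r • (crossedProduct.ofM α b * crossedProduct.u α a) *
        crossedProduct.ofM α (t • twistedWord α g m l₁) *
          (crossedProduct.ofM α (m i) * crossedProduct.u α (g i)) =
        (r * t) • (crossedProduct.ofM α (b * α a (twistedWord α g m l₁ * m i)) *
          crossedProduct.u α (a * g i)) := by
      rw [map_smul, smul_mul_smul_comm, smul_mul_assoc, crossedProduct.ofM_mul_u_mul]
    have eT : r • groupVN.u a * algebraMap ℂ (groupVN G) t * groupVN.u (g i) =
        (r * t) • groupVN.u (a * g i) := by
      rw [← Algebra.commutes, ← Algebra.smul_def, smul_smul, mul_comm t, smul_mul_assoc,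
        groupVN.u_mul]
    rw [eM, eT]
    obtain ⟨h3, h4⟩ := ih' l₂ (by simp; omega) k (r * t)
      (b * α a (twistedWord α g m l₁ * m i)) (a * g i)
    rw [h3]
    -- If this moment is nonzero, so is its factor `t`, hence the group product over `l₁` is `1`.
    by_cases h0 : momentTr (some (k, (r * t) • groupVN.u (a * g i))) l₂ = 0
    · simp [h0]
    · obtain ⟨hrt, hp⟩ := h4 h0
      have hp₁ := h2 (right_ne_zero_of_mul hrt)
      refine ⟨?_, fun _ ↦ ⟨left_ne_zero_of_mul hrt, ?_⟩⟩
      -- The twist that `l₁` would impose on `i :: l₂` is now the identity.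
      · rw [twistedWord_append, hp₁]
        simp [twistedWord, mul_assoc]
      · simpa [hp₁, mul_assoc] using hp

theorem nestedMoment_none_eq_smul (l : List ι) :
    momentM none l = momentTr none l • twistedWord α g m l :=
  (nestedMoment_none_of_nestedMoment_some α c g m
    fun l' _ ↦ nestedMoment_some_eq_smul α c g m l').1

theorem partitionMoment_eq_smul_twistedProduct {n : ℕ} (g : Fin n → G) (m : Fin n → M)
    (π : NC n) :
    partitionMoment (crossedProduct.ofM α) (crossedProduct.condExp α)
        (fun i ↦ crossedProduct.ofM α (m i) * crossedProduct.u α (g i)) π =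
      partitionMoment (algebraMap ℂ (groupVN G)) groupVN.tr (fun i ↦ groupVN.u (g i)) π •
        twistedProduct α g m := by
  rw [twistedProduct_eq_twistedWord]
  exact nestedMoment_none_eq_smul α _ g m _

end Crossed

end CrossedProduct

theorem mainTheorem2 {H : Type*} [NormedAddCommGroup H] [InnerProductSpace ℂ H] [CompleteSpace H]
    (M : VonNeumannAlgebra H) {G : Type*} [Group G] (α : G →* (M ≃⋆ₐ[ℂ] M))
    (n : ℕ) (g : Fin n → G) (m : Fin n → M) :
    CrossedProduct.freeCumulant (CrossedProduct.crossedProduct.ofM α)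
        (CrossedProduct.crossedProduct.condExp α)
        (fun i ↦ CrossedProduct.crossedProduct.ofM α (m i) * CrossedProduct.crossedProduct.u α (g i)) =
      CrossedProduct.freeCumulant (algebraMap ℂ (CrossedProduct.groupVN G))
        CrossedProduct.groupVN.tr (fun i ↦ CrossedProduct.groupVN.u (g i)) •
          CrossedProduct.twistedProduct α g m ∧
    ∀ π : CrossedProduct.NC n,
      CrossedProduct.partitionMoment (CrossedProduct.crossedProduct.ofM α)
        (CrossedProduct.crossedProduct.condExp α)
        (fun i ↦ CrossedProduct.crossedProduct.ofM α (m i) * CrossedProduct.crossedProduct.u α (g i)) π =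
      CrossedProduct.partitionMoment (algebraMap ℂ (CrossedProduct.groupVN G))
        CrossedProduct.groupVN.tr (fun i ↦ CrossedProduct.groupVN.u (g i)) π •
          CrossedProduct.twistedProduct α g m := by
  have h := CrossedProduct.partitionMoment_eq_smul_twistedProduct α g m
  refine ⟨?_, h⟩
  simp only [CrossedProduct.freeCumulant, h, Finset.sum_smul, smul_assoc]
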